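/- Let $0<s<1$, let $n\ge 1$ be an integer with $n\ge 2s$, let $\mathbb{R}^n_+=\{x\in\mathbb{R}^n: x_n>0\}$, and let $f:[0,\infty)\to\mathbb{R}$ be continuous with $f(0)\ge 0$. By a solution we mean a function $u:\mathbb{R}^n\to\mathbb{R}$ in $C^{1,1}_{loc}(\mathbb{R}^n_+)$, locally integrable with $\int_{\mathbb{R}^n}\frac{|u(x)|}{1+|x|^{n+2s}}\,dx<\infty$, such that $$(-\Delta)^s u(x)=C_{n,s}\,\mathrm{PV}\!\int_{\mathbb{R}^n}\frac{u(x)-u(y)}{|x-y|^{n+2s}}\,dy=f(u(x))\quad (x\in\mathbb{R}^n_+),\qquad u(x)=0\quad (x\in\mathbb{R}^n\setminus\mathbb{R}^n_+),$$ where PV denotes the Cauchy principal value and $C_{n,s}=\frac{4^s\,s\,\Gamma(n/2+s)}{\pi^{n/2}\,\Gamma(1-s)}$. For a bounded domain (nonempty connected open set) $D\subset\mathbb{R}^n_+$ and $R>0$ put $$D_R=\Big\{x\in\mathbb{R}^n\setminus D:\ \mathrm{dist}(x,D)\le R,\ x_n\ge \tfrac12\,\mathrm{dist}(D,\partial\mathbb{R}^n_+)\Big\}.$$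 Theorem (averaging effects). Let $R>0$, $C_0>0$, and let $\omega:(0,\infty)\to(0,\infty)$ be any function. Then there is a constant $\delta_0>0$, depending only on $R$, $C_0$ and the data $n,s,f,\omega$, with the following property. If $u\ge 0$ is a solution that is uniformly continuous on $\mathbb{R}^n$ with modulus $\omega$, i.e. $|u(x)-u(y)|<\varepsilon$ whenever $\varepsilon>0$ and $|x-y|<\omega(\varepsilon)$, and if $D\subset\mathbb{R}^n_+$ is a bounded domain with $u\ge C_0$ on $D$, then $$u(x)\ge\delta_0\qquad\text{for all }x\in D_R.$$ In particular, for a given nonnegative uniformly continuous solution $u$, the constant $\delta_0$ depends only on $R$ and $C_0$, and not on $D$ or its location. -/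

import Mathlib

open Set Filter Topology MeasureTheory

noncomputable section

namespace AveragingEffects

/-- Euclidean space of dimension `d + 1`, written `n = d + 1` in the comments below; the coordinate
`x_n` of a point `x` is `x (Fin.last d)`. -/
abbrev Space (d : ℕ) : Type := EuclideanSpace ℝ (Fin (d + 1))

/-- The open half-space `{x | x_n > 0}`. -/
def halfSpace (d : ℕ) : Set (Space d) := {x | 0 < x (Fin.last d)}

/-- The distance `inf {|x - y| : x ∈ A, y ∈ B}` between two (nonempty) sets. -/
def setDist {d : ℕ} (A B : Set (Space d)) : ℝ := ⨅ x : A, Metric.infDist (x : Space d) B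

/-- The set `D_R`: points outside `D`, at distance at most `R` from `D`, whose height is at least
half the distance of `D` to the boundary of the half-space. -/
def enlargement {d : ℕ} (D : Set (Space d)) (R : ℝ) : Set (Space d) :=
  {x | x ∉ D ∧ Metric.infDist x D ≤ R ∧
    setDist D (frontier (halfSpace d)) / 2 ≤ x (Fin.last d)}

/-- The usual normalization constant of the fractional Laplacian in dimension `n = d + 1`,
`C_{n,s} = 4^s s Γ(n/2 + s) / (π^{n/2} Γ(1 - s))`. -/
def fracLapConst (d : ℕ) (s : ℝ) : ℝ :=
  4 ^ s * s * Real.Gamma (((d : ℝ) + 1) / 2 + s) /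
    (Real.pi ^ (((d : ℝ) + 1) / 2) * Real.Gamma (1 - s))

/-- The integrand `(u(x) - u(y)) / |x - y|^{n + 2s}` as a function of `y`. -/
def fracLapKernel {d : ℕ} (s : ℝ) (u : Space d → ℝ) (x y : Space d) : ℝ :=
  (u x - u y) / ‖x - y‖ ^ ((d : ℝ) + 1 + 2 * s)

/-- `(-Δ)^s u (x) = L`: the integral over the complement of the ball of radius `ε` about `x`
converges absolutely for every `ε > 0`, and `C_{n,s}` times it tends to `L` as `ε → 0`
(Cauchy principal value). -/
def HasFracLapAt {d : ℕ} (s : ℝ) (u : Space d → ℝ) (x : Space d) (L : ℝ) : Prop :=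
  (∀ ε : ℝ, 0 < ε → IntegrableOn (fracLapKernel s u x) (Metric.ball x ε)ᶜ) ∧
  Tendsto (fun ε : ℝ => fracLapConst d s * ∫ y in (Metric.ball x ε)ᶜ, fracLapKernel s u x y)
    (𝓝[>] 0) (𝓝 L)

/-- The space `𝓛_{2s}` of locally integrable `u` with `∫ |u(x)| / (1 + |x|^{n+2s}) dx < ∞`. -/
def MemL2s {d : ℕ} (s : ℝ) (u : Space d → ℝ) : Prop :=
  LocallyIntegrable u ∧
  Integrable (fun x : Space d => |u x| / (1 + ‖x‖ ^ ((d : ℝ) + 1 + 2 * s)))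

/-- `u ∈ C^{1,1}_loc(Ω)` for an open set `Ω`: `u` is differentiable in `Ω` and its derivative is
locally Lipschitz there. -/
def IsC11Loc {d : ℕ} (Ω : Set (Space d)) (u : Space d → ℝ) : Prop :=
  DifferentiableOn ℝ u Ω ∧ LocallyLipschitzOn Ω (fderiv ℝ u)

/-- `u` is a classical solution of `(-Δ)^s u = f(u)` in the half-space, `u = 0` outside. -/
structure IsSolution {d : ℕ} (s : ℝ) (f : ℝ → ℝ) (u : Space d → ℝ) : Prop where
  c11 : IsC11Loc (halfSpace d) u
  memL2s : MemL2s s u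
  equation : ∀ x ∈ halfSpace d, HasFracLapAt s u x (f (u x))
  exterior : ∀ x ∉ halfSpace d, u x = 0

end AveragingEffects

end

open scoped RealInnerProductSpace

namespace AveragingEffects

/-! Argue by contradiction at a point `x` of the enlargement with `u x < δ`. Subtracting from `u` a
paraboloid of height `2δ` about `x` gives a global minimum at a nearby `z`
(`exists_touching_point`). There `u` is touched from below up to size `O(δ)`, so only `O(δ)` can
push `(-Δ)^s u(z)` up, while a ball of fixed size at bounded distance, where `u > C₀/2`, pushes it
down by a fixed amount (`HasFracLapAt.le_of_touching`). Since `f(0) ≥ 0` and `0 ≤ u z < 2δ`,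
continuity makes `f (u z)` almost nonnegative, which is absurd for small `δ`. The modulus `ω`
removes the dependence on `D`: it keeps `D` off the boundary, so that `z` stays in the half-space,
and it supplies the ball even if `D` is tiny. -/

theorem fracLapConst_pos (d : ℕ) {s : ℝ} (hs₀ : 0 < s) (hs₁ : s < 1) : 0 < fracLapConst d s := by
  unfold fracLapConst
  have h₁ : 0 < Real.Gamma (((d : ℝ) + 1) / 2 + s) := Real.Gamma_pos_of_pos (by positivity)
  have h₂ : 0 < Real.Gamma (1 - s) := Real.Gamma_pos_of_pos (by linarith)
  positivity

/-! ### Majorants of the singular integrand -/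

/-- The radial profile `min(t², 1) / t^{n + 2s}`, with the transition at `t = ρ`. -/
noncomputable def radialProfile (d : ℕ) (s ρ t : ℝ) : ℝ :=
  (if t < ρ then t ^ 2 else 1) / t ^ ((d : ℝ) + 1 + 2 * s)

theorem radialProfile_nonneg (d : ℕ) (s ρ : ℝ) {t : ℝ} (ht : 0 ≤ t) :
    0 ≤ radialProfile d s ρ t := by
  unfold radialProfile
  split_ifs <;> positivity

/-- In polar coordinates the integrand is `t ^ (1 - 2s)` near zero, integrable as `s < 1`, and `t ^
(-1 - 2s)` at infinity, integrable as `s > 0`. -/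
theorem integrable_radialProfile (d : ℕ) {s ρ : ℝ} (hs₀ : 0 < s) (hs₁ : s < 1) (hρ : 0 < ρ) :
    Integrable (fun z : Space d => radialProfile d s ρ ‖z‖) := by
  rw [integrable_fun_norm_addHaar (μ := (volume : Measure (Space d))) (f := radialProfile d s ρ),
    ← Ioo_union_Ici_eq_Ioi hρ, integrableOn_union]
  have hdim : Module.finrank ℝ (Space d) - 1 = d := by simp
  rw [hdim]
  constructor
  · have h : IntegrableOn (fun t : ℝ => t ^ (1 - 2 * s)) (Ioo 0 ρ) :=
      (intervalIntegral.integrableOn_Ioo_rpow_iff hρ).2 (by linarith)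
    refine h.congr_fun (fun t ht => ?_) measurableSet_Ioo
    have ht₀ : 0 < t := ht.1
    simp only [radialProfile, if_pos ht.2, smul_eq_mul]
    rw [← mul_div_assoc, ← pow_add, ← Real.rpow_natCast, ← Real.rpow_sub ht₀]
    congr 1
    push_cast
    ring
  · have h : IntegrableOn (fun t : ℝ => t ^ (-1 - 2 * s)) (Ici ρ) :=
      (integrableOn_Ici_iff_integrableOn_Ioi (by simp)).2 (integrableOn_Ioi_rpow_of_lt (by linarith) hρ)
    refine h.congr_fun (fun t ht => ?_) measurableSet_Ici
    have ht₀ : 0 < t := hρ.trans_le ht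
    simp only [radialProfile, if_neg (not_lt.2 (mem_Ici.1 ht)), smul_eq_mul]
    rw [mul_one_div, ← Real.rpow_natCast, ← Real.rpow_sub ht₀]
    congr 1
    ring

/-- The linear part of the singular integrand near its centre, cut off at radii `ε` and `ρ`. -/
noncomputable def annularLinear {d : ℕ} (s ε ρ : ℝ) (g z : Space d) : ℝ :=
  {z : Space d | ε ≤ ‖z‖ ∧ ‖z‖ < ρ}.indicator
    (fun z => ⟪g, z⟫ / ‖z‖ ^ ((d : ℝ) + 1 + 2 * s)) z

/-- The integrand is odd. Thus the first-order term drops out for each `ε`, before any limit is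
taken. -/
theorem integral_annularLinear {d : ℕ} (s ε ρ : ℝ) (g : Space d) :
    ∫ z, annularLinear s ε ρ g z = 0 := by
  have h : ∀ z, annularLinear s ε ρ g (-z) = -annularLinear s ε ρ g z := by
    intro z
    by_cases hz : ε ≤ ‖z‖ ∧ ‖z‖ < ρ <;>
      simp [annularLinear, indicator, hz, neg_div]
  have h' := integral_neg_eq_self (annularLinear s ε ρ g) volume
  simp only [h, integral_neg] at h'
  linarith

theorem measurableSet_annulus (d : ℕ) (ε ρ : ℝ) :
    MeasurableSet {z : Space d | ε ≤ ‖z‖ ∧ ‖z‖ < ρ} :=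
  (measurableSet_le measurable_const measurable_norm).inter
    (measurableSet_lt measurable_norm measurable_const)

theorem integrable_annularLinear {d : ℕ} {s ε ρ : ℝ} (hs₀ : 0 < s) (hε : 0 < ε) (g : Space d) :
    Integrable (annularLinear s ε ρ g) := by
  refine (integrable_indicator_iff (measurableSet_annulus d ε ρ)).2 ?_
  refine Measure.integrableOn_of_bounded (M := ‖g‖ * ρ / ε ^ ((d : ℝ) + 1 + 2 * s)) ?_ ?_ ?_
  · refine ((measure_mono fun z hz => ?_).trans_lt
      (measure_ball_lt_top (x := (0 : Space d)) (r := ρ))).ne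
    simpa using hz.2
  · exact Measurable.aestronglyMeasurable (by fun_prop)
  · refine (ae_restrict_mem (measurableSet_annulus d ε ρ)).mono fun z hz => ?_
    have hz₀ : 0 < ‖z‖ := hε.trans_le hz.1
    rw [norm_div, Real.norm_of_nonneg (Real.rpow_nonneg hz₀.le _)]
    have h₁ : ‖⟪g, z⟫‖ ≤ ‖g‖ * ρ :=
      (norm_inner_le_norm g z).trans (mul_le_mul_of_nonneg_left hz.2.le (norm_nonneg g))
    have h₂ : ε ^ ((d : ℝ) + 1 + 2 * s) ≤ ‖z‖ ^ ((d : ℝ) + 1 + 2 * s) :=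
      Real.rpow_le_rpow hε.le hz.1 (by positivity)
    have h₃ : 0 < ε ^ ((d : ℝ) + 1 + 2 * s) := by positivity
    have h₄ : 0 ≤ ‖g‖ * ρ := (norm_nonneg _).trans h₁
    gcongr

/-- If `u` is touched from below at `x`, up to the size `κ`, by a semiconvex function, and
`u ≥ u(x) + c` on a set `A` at distance between `ρ` and `L` from `x`, then `A` pushes the
fractional Laplacian of `u` at `x` down. -/
theorem HasFracLapAt.le_of_touching {d : ℕ} {s ρ κ c L ℓ : ℝ} {u : Space d → ℝ} {x g : Space d}
    {A : Set (Space d)} (hu : HasFracLapAt s u x ℓ) (hs₀ : 0 < s) (hs₁ : s < 1) (hρ : 0 < ρ)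
    (hκ : 0 ≤ κ) (hc : 0 ≤ c) (hA : MeasurableSet A) (hAfin : volume A ≠ ⊤)
    (hnear : ∀ y, u x - u y ≤ ⟪g, y - x⟫ + κ * ‖y - x‖ ^ 2) (hfar : ∀ y, u x - u y ≤ κ)
    (hAdist : ∀ y ∈ A, ρ ≤ ‖y - x‖ ∧ ‖y - x‖ ≤ L) (hAu : ∀ y ∈ A, u x - u y ≤ -c) :
    ℓ ≤ fracLapConst d s * (κ * (∫ z : Space d, radialProfile d s ρ ‖z‖) -
      c / L ^ ((d : ℝ) + 1 + 2 * s) * volume.real A) := by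
  refine le_of_tendsto hu.2 ?_
  filter_upwards [Ioo_mem_nhdsGT hρ] with ε hε
  refine mul_le_mul_of_nonneg_left ?_ (fracLapConst_pos d hs₀ hs₁).le
  have hprof := (integrable_radialProfile d hs₀ hs₁ hρ).comp_sub_right x
  have hlin := (integrable_annularLinear (ρ := ρ) hs₀ hε.1 g).comp_sub_right x
  have hcA : Integrable (A.indicator fun _ => c / L ^ ((d : ℝ) + 1 + 2 * s)) :=
    (integrable_indicator_iff hA).2 (integrableOn_const hAfin)
  have hadd : Integrable fun y => annularLinear s ε ρ g (y - x) +
      κ * radialProfile d s ρ ‖y - x‖ := hlin.add (hprof.const_mul κ)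
  have hint : Integrable fun y => annularLinear s ε ρ g (y - x) +
      κ * radialProfile d s ρ ‖y - x‖ - A.indicator (fun _ => c / L ^ ((d : ℝ) + 1 + 2 * s)) y :=
    hadd.sub hcA
  have hSm : MeasurableSet (Metric.ball x ε)ᶜ := measurableSet_ball.compl
  have hpoint : ∀ y ∈ (Metric.ball x ε)ᶜ, fracLapKernel s u x y ≤
      annularLinear s ε ρ g (y - x) + κ * radialProfile d s ρ ‖y - x‖ -
        A.indicator (fun _ => c / L ^ ((d : ℝ) + 1 + 2 * s)) y := by
    intro y hy
    have hyε : ε ≤ ‖y - x‖ := by simpa [dist_eq_norm] using hy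
    have hy₀ : 0 < ‖y - x‖ := hε.1.trans_le hyε
    have hpow : 0 < ‖y - x‖ ^ ((d : ℝ) + 1 + 2 * s) := by positivity
    rw [fracLapKernel, norm_sub_rev x y]
    by_cases hyρ : ‖y - x‖ < ρ
    · have hyA : y ∉ A := fun h => hyρ.not_ge (hAdist y h).1
      rw [indicator_of_notMem hyA, annularLinear,
        indicator_of_mem (show y - x ∈ {z : Space d | ε ≤ ‖z‖ ∧ ‖z‖ < ρ} from ⟨hyε, hyρ⟩),
        radialProfile, if_pos hyρ, sub_zero, ← mul_div_assoc, ← add_div]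
      gcongr
      exact hnear y
    · rw [annularLinear, indicator_of_notMem (fun h => hyρ h.2), radialProfile, if_neg hyρ, zero_add]
      by_cases hyA : y ∈ A
      · rw [indicator_of_mem hyA]
        have h₁ : (u x - u y) / ‖y - x‖ ^ ((d : ℝ) + 1 + 2 * s) ≤
            -c / ‖y - x‖ ^ ((d : ℝ) + 1 + 2 * s) := by
          gcongr
          exact hAu y hyA
        have h₂ : c / L ^ ((d : ℝ) + 1 + 2 * s) ≤ c / ‖y - x‖ ^ ((d : ℝ) + 1 + 2 * s) := by
          gcongr
          exact (hAdist y hyA).2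
        have h₃ : 0 ≤ κ * (1 / ‖y - x‖ ^ ((d : ℝ) + 1 + 2 * s)) := by positivity
        rw [neg_div] at h₁
        linarith
      · rw [indicator_of_notMem hyA, sub_zero, mul_one_div]
        gcongr
        exact hfar y
  calc ∫ y in (Metric.ball x ε)ᶜ, fracLapKernel s u x y
      ≤ ∫ y in (Metric.ball x ε)ᶜ, (annularLinear s ε ρ g (y - x) +
          κ * radialProfile d s ρ ‖y - x‖ -
            A.indicator (fun _ => c / L ^ ((d : ℝ) + 1 + 2 * s)) y) :=
        setIntegral_mono_on (hu.1 ε hε.1) hint.integrableOn hSm hpoint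
    _ ≤ ∫ y, (annularLinear s ε ρ g (y - x) + κ * radialProfile d s ρ ‖y - x‖ -
            A.indicator (fun _ => c / L ^ ((d : ℝ) + 1 + 2 * s)) y) := by
        -- Restoring the small ball can only increase the integral: there the linear part is cut off
        -- and `A` is absent, as `ε < ρ`.
        rw [← integral_indicator hSm]
        refine integral_mono (hint.indicator hSm) hint fun y => ?_
        by_cases hy : y ∈ (Metric.ball x ε)ᶜ
        · rw [indicator_of_mem hy]
        · rw [indicator_of_notMem hy]
          have hyε : ‖y - x‖ < ε := by simpa [dist_eq_norm] using hy
          have hyA : y ∉ A := fun h => (hyε.trans hε.2).not_ge (hAdist y h).1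
          rw [indicator_of_notMem hyA, annularLinear,
            indicator_of_notMem (fun h => hyε.not_ge h.1), zero_add, sub_zero]
          exact mul_nonneg hκ (radialProfile_nonneg d s ρ (norm_nonneg _))
    _ = κ * (∫ z : Space d, radialProfile d s ρ ‖z‖) -
          c / L ^ ((d : ℝ) + 1 + 2 * s) * volume.real A := by
        rw [integral_sub hadd hcA,
          integral_add hlin (hprof.const_mul κ), integral_const_mul,
          integral_sub_right_eq_self (annularLinear s ε ρ g) x, integral_annularLinear,
          integral_sub_right_eq_self (fun z : Space d => radialProfile d s ρ ‖z‖) x,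
          integral_indicator_const _ hA, smul_eq_mul]
        ring

/-! ### Touching from below by paraboloids -/

/-- The truncated paraboloid `max(0, 1 - |y - x|² / r²)`. -/
noncomputable def paraboloid {d : ℕ} (x : Space d) (r : ℝ) (y : Space d) : ℝ := max 0 (1 - ‖y - x‖ ^ 2 / r ^ 2)

theorem continuous_paraboloid {d : ℕ} (x : Space d) (r : ℝ) : Continuous (paraboloid x r) := by
  unfold paraboloid
  fun_prop

theorem paraboloid_le_one {d : ℕ} (x y : Space d) (r : ℝ) : paraboloid x r y ≤ 1 :=
  max_le zero_le_one (sub_le_self _ (by positivity))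

theorem paraboloid_nonneg {d : ℕ} (x y : Space d) (r : ℝ) : 0 ≤ paraboloid x r y :=
  le_max_left _ _

theorem paraboloid_self {d : ℕ} (x : Space d) (r : ℝ) : paraboloid x r x = 1 := by
  simp [paraboloid]

theorem paraboloid_eq_zero {d : ℕ} {x y : Space d} {r : ℝ} (hr : 0 < r) (hy : r ≤ ‖y - x‖) :
    paraboloid x r y = 0 := by
  refine max_eq_left (sub_nonpos.2 ((one_le_div (by positivity)).2 ?_))
  gcongr

/-- Semiconvexity of the truncated paraboloid at a point where it is positive. -/
theorem paraboloid_sub_le {d : ℕ} {x z : Space d} {r : ℝ} (hz : 0 < paraboloid x r z)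
    (y : Space d) :
    paraboloid x r z - paraboloid x r y ≤ 2 / r ^ 2 * ⟪z - x, y - z⟫ + 1 / r ^ 2 * ‖y - z‖ ^ 2 := by
  have h₁ : paraboloid x r z = 1 - ‖z - x‖ ^ 2 / r ^ 2 := by
    rcases max_choice 0 (1 - ‖z - x‖ ^ 2 / r ^ 2) with h | h
    · exact absurd h hz.ne'
    · exact h
  have h₂ : 1 - ‖y - x‖ ^ 2 / r ^ 2 ≤ paraboloid x r y := le_max_right _ _
  have h₃ : ‖y - x‖ ^ 2 = ‖z - x‖ ^ 2 + 2 * ⟪z - x, y - z⟫ + ‖y - z‖ ^ 2 := by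
    rw [← norm_add_sq_real]
    congr 2
    abel
  rw [h₃, add_div, add_div] at h₂
  have h₄ : 2 / r ^ 2 * ⟪z - x, y - z⟫ + 1 / r ^ 2 * ‖y - z‖ ^ 2 =
      2 * ⟪z - x, y - z⟫ / r ^ 2 + ‖y - z‖ ^ 2 / r ^ 2 := by ring
  linarith

/-- If a nonnegative continuous function is below `δ` at `x`, then subtracting a paraboloid of
height `2δ` creates a global minimum near `x`. -/
theorem exists_touching_point {d : ℕ} {u : Space d → ℝ} (hu : Continuous u) (hu₀ : ∀ x, 0 ≤ u x)
    {x : Space d} {r δ : ℝ} (hr : 0 < r) (hδ : u x < δ) :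
    ∃ z, ‖z - x‖ < r ∧ 0 < paraboloid x r z ∧ u z < 2 * δ ∧
      ∀ y, u z - u y ≤ 2 * δ * (paraboloid x r z - paraboloid x r y) := by
  have hδ₀ : 0 < δ := (hu₀ x).trans_lt hδ
  obtain ⟨z, -, hz⟩ := (isCompact_closedBall x r).exists_isMinOn
    ⟨x, Metric.mem_closedBall_self hr.le⟩
    (hu.sub ((continuous_paraboloid x r).const_smul (2 * δ))).continuousOn
  have hmin : ∀ y, ‖y - x‖ ≤ r →
      u z - 2 * δ * paraboloid x r z ≤ u y - 2 * δ * paraboloid x r y := fun y hy =>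
    hz (show y ∈ Metric.closedBall x r by simpa [dist_eq_norm] using hy)
  have hx := hmin x (by simpa using hr.le)
  rw [paraboloid_self] at hx
  -- The minimum is negative, its value at `x` being below `δ - 2δ`, whereas `u ≥ 0`.
  have hpos : 0 < paraboloid x r z := by
    by_contra h
    have := mul_nonpos_of_nonneg_of_nonpos (mul_pos two_pos hδ₀).le (not_lt.1 h)
    linarith [hu₀ z]
  refine ⟨z, ?_, hpos, ?_, fun y => ?_⟩
  · by_contra h
    exact hpos.ne' (paraboloid_eq_zero hr (not_lt.1 h))
  · have := mul_le_mul_of_nonneg_left (paraboloid_le_one x z r) (mul_pos two_pos hδ₀).le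
    linarith
  · rcases le_total ‖y - x‖ r with h | h
    · linarith [hmin y h]
    · rw [paraboloid_eq_zero hr h]
      linarith [hu₀ y]

/-! ### Geometry of the half-space and the modulus of continuity -/

theorem isOpen_halfSpace (d : ℕ) : IsOpen (halfSpace d) :=
  isOpen_lt continuous_const (by fun_prop)

theorem frontier_halfSpace_nonempty (d : ℕ) : (frontier (halfSpace d)).Nonempty := by
  refine nonempty_frontier_iff.2 ⟨⟨EuclideanSpace.single (Fin.last d) 1, by simp [halfSpace]⟩, ?_⟩
  intro h
  have : (0 : Space d) ∈ halfSpace d := h ▸ mem_univ _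
  simp [halfSpace] at this

theorem le_setDist {d : ℕ} {A B : Set (Space d)} {h : ℝ} (hA : A.Nonempty) (hB : B.Nonempty)
    (hAB : ∀ x ∈ A, ∀ y ∈ B, h ≤ dist x y) : h ≤ setDist A B := by
  have := hA.to_subtype
  exact le_ciInf fun x => (Metric.le_infDist hB).2 fun y hy => hAB x x.2 y hy

theorem mem_halfSpace_of_norm_sub_lt {d : ℕ} {x z : Space d}
    (h : ‖z - x‖ < x (Fin.last d)) : z ∈ halfSpace d := by
  have h₁ : |z (Fin.last d) - x (Fin.last d)| ≤ ‖z - x‖ := by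
    simpa using PiLp.norm_apply_le (z - x) (Fin.last d)
  have h₂ := neg_abs_le (z (Fin.last d) - x (Fin.last d))
  show 0 < z (Fin.last d)
  linarith

/-- A function that is at least `C₀` on `D ⊆ halfSpace d` and vanishes outside the half-space keeps
`D` at distance `ω C₀` from the boundary. -/
theorem le_setDist_frontier_halfSpace {d : ℕ} {u : Space d → ℝ} {D : Set (Space d)} {C₀ h : ℝ}
    (hext : ∀ x ∉ halfSpace d, u x = 0) (hmod : ∀ x y, dist x y < h → dist (u x) (u y) < C₀)
    (hD : D.Nonempty) (hDu : ∀ x ∈ D, C₀ ≤ u x) :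
    h ≤ setDist D (frontier (halfSpace d)) := by
  refine le_setDist hD (frontier_halfSpace_nonempty d) fun x hx y hy => ?_
  have hy' : y ∉ halfSpace d := fun hy' => by
    rw [(isOpen_halfSpace d).frontier_eq] at hy
    exact hy.2 hy'
  by_contra! hlt
  have h₁ := hmod x y hlt
  rw [hext y hy', Real.dist_eq, sub_zero] at h₁
  linarith [hDu x hx, le_abs_self (u x)]

theorem continuous_of_modulus {d : ℕ} {u : Space d → ℝ} {ω : ℝ → ℝ} (hω : ∀ ε, 0 < ε → 0 < ω ε)
    (hmod : ∀ ε : ℝ, 0 < ε → ∀ x y, dist x y < ω ε → dist (u x) (u y) < ε) : Continuous u :=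
  Metric.continuous_iff.2 fun x ε hε => ⟨ω ε, hω ε hε, fun y hy => hmod ε hε y x hy⟩

/-! ### Choice of the constant and conclusion -/

/-- The choice of the constant: a term linear in `δ` and the negative part of `f` on `[0, 2δ)` are
both dominated by `q`. -/
theorem exists_small_threshold {f : ℝ → ℝ} (hf : ContinuousOn f (Ici 0)) (hf₀ : 0 ≤ f 0)
    {q m : ℝ} (P : ℝ) (hq : 0 < q) (hm : 0 < m) :
    ∃ δ, 0 < δ ∧ 2 * δ ≤ m ∧ ∀ t, 0 ≤ t → t < 2 * δ → 2 * δ * P - q < f t := by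
  obtain ⟨η, hη, hfη⟩ := Metric.continuousOn_iff.1 hf 0 self_mem_Ici (q / 2) (half_pos hq)
  have hP : 0 < |P| + 1 := by positivity
  set τ := min (min m η) (q / 2 / (|P| + 1))
  have hτ₀ : 0 < τ := by positivity
  refine ⟨τ / 2, half_pos hτ₀, ?_, fun t ht₀ ht => ?_⟩
  · linarith [min_le_left (min m η) (q / 2 / (|P| + 1)), min_le_left m η]
  · have htη : t < η := by
      linarith [min_le_left (min m η) (q / 2 / (|P| + 1)), min_le_right m η]
    have h₁ := hfη t ht₀ (by rwa [Real.dist_eq, sub_zero, abs_of_nonneg ht₀])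
    rw [Real.dist_eq, abs_lt] at h₁
    have h₂ : τ * (|P| + 1) ≤ q / 2 := (le_div_iff₀ hP).1 (min_le_right _ _)
    have h₃ : τ * P ≤ τ * (|P| + 1) :=
      mul_le_mul_of_nonneg_left (by linarith [le_abs_self P]) hτ₀.le
    have h₄ : 2 * (τ / 2) * P = τ * P := by ring
    linarith [h₁.1]

end AveragingEffects

open AveragingEffects in
/-- Averaging effects. The function `ω` prescribes a modulus of uniform continuity; the constant
`δ₀` is chosen before the solution `u` and the domain `D`. -/
theorem theorem1p5 (d : ℕ) (s : ℝ) (hs₀ : 0 < s) (hs₁ : s < 1) (hn : 2 * s ≤ (d : ℝ) + 1)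
    (f : ℝ → ℝ) (hf : ContinuousOn f (Set.Ici 0)) (hf₀ : 0 ≤ f 0)
    (ω : ℝ → ℝ) (hω : ∀ ε : ℝ, 0 < ε → 0 < ω ε)
    (R : ℝ) (hR : 0 < R) (C₀ : ℝ) (hC₀ : 0 < C₀) :
    ∃ δ₀ : ℝ, 0 < δ₀ ∧
      ∀ u : AveragingEffects.Space d → ℝ,
        AveragingEffects.IsSolution s f u →
        (∀ x, 0 ≤ u x) →
        (∀ ε : ℝ, 0 < ε → ∀ x y, dist x y < ω ε → dist (u x) (u y) < ε) →
        ∀ D : Set (AveragingEffects.Space d),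
          IsOpen D → IsConnected D → Bornology.IsBounded D →
          D ⊆ AveragingEffects.halfSpace d →
          (∀ x ∈ D, C₀ ≤ u x) →
          ∀ x ∈ AveragingEffects.enlargement D R, δ₀ ≤ u x := by
  set r₀ := min (ω (C₀ / 2)) 1 with hr₀_def
  have hr₀ : 0 < r₀ := lt_min (hω _ (half_pos hC₀)) one_pos
  set r := ω C₀ / 4 with hr_def
  have hr : 0 < r := div_pos (hω _ hC₀) four_pos
  -- Bounds the path from `z` via `x` and a point `p` of `D` to the ball about `p`; the extra 1 is
  -- there because the distance to `D` need not be attained.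
  set L := r + (R + 1) + r₀ with hL_def
  have hL : 0 < L := by positivity
  set v := volume.real (Metric.ball (0 : Space d) (r₀ / 2)) with hv_def
  have hv : 0 < v := ENNReal.toReal_pos
    (Metric.measure_ball_pos _ _ (half_pos hr₀)).ne' measure_ball_lt_top.ne
  set M := ∫ z : Space d, radialProfile d s (r₀ / 2) ‖z‖ with hM_def
  have hC := fracLapConst_pos d hs₀ hs₁
  set q := fracLapConst d s * (C₀ / 4 / L ^ ((d : ℝ) + 1 + 2 * s) * v) with hq_def
  have hq : 0 < q := by positivity
  obtain ⟨δ, hδ, hδC, hfδ⟩ := exists_small_threshold hf hf₀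
    (fracLapConst d s * ((1 + 1 / r ^ 2) * M)) hq (show 0 < C₀ / 4 by positivity)
  refine ⟨δ, hδ, fun u hsol hu₀ hmod D _ hDconn _ _ hDu x hx => ?_⟩
  by_contra! hxδ
  obtain ⟨-, hxR, hxh⟩ := hx
  obtain ⟨p, hpD, hxp⟩ := (Metric.infDist_lt_iff hDconn.nonempty).1
    (show Metric.infDist x D < R + 1 by linarith)
  have hdist := le_setDist_frontier_halfSpace hsol.exterior (hmod C₀ hC₀) hDconn.nonempty hDu
  obtain ⟨z, hzx, hzpos, hzδ, hz⟩ :=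
    exists_touching_point (continuous_of_modulus hω hmod) hu₀ hr hxδ
  -- The height of `x` is at least `ω C₀ / 2 = 2 * r`.
  have hzH : z ∈ halfSpace d := mem_halfSpace_of_norm_sub_lt (by linarith)
  have hball : ∀ y, dist y p < r₀ → C₀ / 2 < u y := by
    intro y hy
    have h₁ := hmod (C₀ / 2) (half_pos hC₀) y p (hy.trans_le (min_le_left _ _))
    rw [Real.dist_eq, abs_lt] at h₁
    linarith [hDu p hpD, h₁.1]
  -- In `κ`, the summand `1 / r ^ 2` serves the quadratic bound and `1` the global one; `c` is `C₀ /
  -- 2` minus the bound `2δ ≤ C₀ / 4` on `u z`.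
  have hle := (hsol.equation z hzH).le_of_touching (ρ := r₀ / 2) (κ := 2 * δ * (1 + 1 / r ^ 2))
    (c := C₀ / 4) (L := L) (g := (2 * δ * (2 / r ^ 2)) • (z - x))
    (A := Metric.ball p (r₀ / 2)) hs₀ hs₁ (half_pos hr₀) (by positivity) (by positivity)
    measurableSet_ball measure_ball_lt_top.ne ?_ ?_ ?_ ?_
  · have hvol : volume.real (Metric.ball p (r₀ / 2)) = v := by
      rw [hv_def, Measure.real, Measure.real, Measure.addHaar_ball_center]
    rw [hvol] at hle
    have h₁ := hfδ (u z) (hu₀ z) hzδ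
    have h₂ : fracLapConst d s * (2 * δ * (1 + 1 / r ^ 2) * M -
        C₀ / 4 / L ^ ((d : ℝ) + 1 + 2 * s) * v) =
        2 * δ * (fracLapConst d s * ((1 + 1 / r ^ 2) * M)) - q := by
      rw [hq_def]
      ring
    linarith
  · intro y
    have h₁ := mul_le_mul_of_nonneg_left (paraboloid_sub_le hzpos y) (mul_pos two_pos hδ).le
    rw [real_inner_smul_left]
    have h₂ : 0 ≤ 2 * δ * ‖y - z‖ ^ 2 := by positivity
    have h₃ := hz y
    linarith
  · intro y
    have h₁ : paraboloid x r z - paraboloid x r y ≤ 1 + 1 / r ^ 2 := by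
      have h₂ : 0 ≤ 1 / r ^ 2 := by positivity
      linarith [paraboloid_le_one x z r, paraboloid_nonneg x y r]
    exact (hz y).trans (mul_le_mul_of_nonneg_left h₁ (mul_pos two_pos hδ).le)
  · intro y hy
    have hyp : dist y p < r₀ / 2 := hy
    rw [← dist_eq_norm] at hzx ⊢
    constructor
    -- Otherwise `z` lies within `r₀` of `p`, where `u > C₀ / 2`, against `u z < C₀ / 4`.
    · by_contra! hyz
      have h₁ := hball z (by linarith [dist_triangle_left z p y])
      linarith
    · linarith [dist_triangle y p z, dist_triangle p x z, dist_comm x p, dist_comm z x]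
  · intro y hy
    have h₁ := hball y (by linarith [Metric.mem_ball.1 hy])
    linarith
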